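/- Let $k\ge 1$ and let $0=r_0<r_1\le r_2\le\dots\le r_k\le r_{k+1}=n$ be integers. For $q=(q_1,\dots,q_k)\in\mathbb{C}^k$ consider, in the $r_1+\dots+r_k$ complex unknowns $z_{s,j}$ ($1\le j\le k$, $1\le s\le r_j$), the system of polynomial equations $$\prod_{a=1}^{r_{j+1}}(z_{s,j}-z_{a,j+1})-q_j\prod_{b=1}^{r_{j-1}}(z_{s,j}-z_{b,j-1})=0\qquad(1\le j\le k,\ 1\le s\le r_j),$$ where $z_{a,k+1}:=0$ for all $1\le a\le n$ and where, for $j=1$, the second product is empty and equals $1$. Let $X(q)$ be the closed subscheme of affine space $\mathbb{A}^{r_1+\dots+r_k}$ over $\mathbb{C}$ cut out by these equations, and let $N(q)$ be the number of its closed points, counted without multiplicity; equivalently, $N(q)$ is the number of distinct complex solutions of the system. Then there is a nonempty Zariski open subset $U\subseteq(\mathbb{C}^*)^k$ such that for every $q\in U$ the system has exactly the Bézout number of distinct solutions, $$N(q)=\prod_{j=1}^k r_{j+1}^{\,r_j},$$ and the number of those solutions that are non-degenerate, i.e. satisfy $z_{s,j}\ne z_{u,j}$ for all $1\le j\le k$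 and all $s\ne u$, is exactly $$\prod_{j=1}^k\frac{r_{j+1}!}{(r_{j+1}-r_j)!}.$$ -/

import Mathlib

open scoped Nat

namespace FlagBethe

/-- Index set of the variables `z_{s,j}`, `1 ≤ j ≤ k`, `1 ≤ s ≤ r_j`. The element `⟨j, s⟩` (both
entries counted from `0`) stands for the variable `z_{s+1, j+1}`. -/
abbrev Idx (k : ℕ) (r : ℕ → ℕ) : Type := Σ j : Fin k, Fin (r (j + 1))

/-- The polynomial `z_{a,j}` for every level `j`: a variable for `1 ≤ j ≤ k`, and `0` for `j = k + 1`.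
(Level `0` has no entries since `r 0 = 0`; levels above `k + 1` are never used.) -/
noncomputable def levelVar (k : ℕ) (r : ℕ → ℕ) : (j : ℕ) → Fin (r j) → MvPolynomial (Idx k r) ℂ
  | 0, _ => 0
  | j + 1, a => if h : j < k then MvPolynomial.X ⟨⟨j, h⟩, a⟩ else 0

/-- The polynomial `∏_a (z_{s,j} - z_{a,j+1}) - q_j ∏_b (z_{s,j} - z_{b,j-1})`, where the level called
`j` in the formula is `i.1 + 1`. -/
noncomputable def eqn (k : ℕ) (r : ℕ → ℕ) (q : Fin k → ℂ) (i : Idx k r) :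
    MvPolynomial (Idx k r) ℂ :=
  ∏ a : Fin (r (i.1 + 2)), (MvPolynomial.X i - levelVar k r (i.1 + 2) a)
    - MvPolynomial.C (q i.1) * ∏ b : Fin (r i.1), (MvPolynomial.X i - levelVar k r i.1 b)

/-- The closed subscheme `X(q)` of affine space cut out by the system. -/
noncomputable def scheme (k : ℕ) (r : ℕ → ℕ) (q : Fin k → ℂ) : AlgebraicGeometry.Scheme :=
  AlgebraicGeometry.Spec
    (CommRingCat.of (MvPolynomial (Idx k r) ℂ ⧸ Ideal.span (Set.range (eqn k r q))))

/-- The number `N(q)` of closed points of `X(q)`, counted without multiplicity. -/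
noncomputable def N (k : ℕ) (r : ℕ → ℕ) (q : Fin k → ℂ) : ℕ∞ :=
  (closedPoints (scheme k r q)).encard

/-- The set of complex solutions of the system. -/
def solutions (k : ℕ) (r : ℕ → ℕ) (q : Fin k → ℂ) : Set (Idx k r → ℂ) :=
  {z | ∀ i, MvPolynomial.eval z (eqn k r q i) = 0}

/-- Non-degenerate: `z_{s,j} ≠ z_{u,j}` for all `j` and all `s ≠ u`. -/
def NonDegenerate {k : ℕ} {r : ℕ → ℕ} (z : Idx k r → ℂ) : Prop :=
  ∀ (j : Fin k) (s u : Fin (r (j + 1))), s ≠ u → z ⟨j, s⟩ ≠ z ⟨j, u⟩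

/-- `p` holds for generic `q` in the torus `(ℂ^*)^k`, i.e. on a nonempty Zariski open subset: it holds
wherever some nonzero polynomial does not vanish. -/
def ForGeneric (k : ℕ) (p : (Fin k → ℂ) → Prop) : Prop :=
  ∃ F : MvPolynomial (Fin k) ℂ, F ≠ 0 ∧
    ∀ q : Fin k → ℂ, (∀ j, q j ≠ 0) → MvPolynomial.eval q F ≠ 0 → p q

end FlagBethe

namespace FlagBethe

open MvPolynomial

/-! The count is an upper bound at `q = 0` met by a lower bound near a toric degeneration; both hold
off a proper closed set.

Upper bound (`exists_generic_encard_le`). At `q = 0` the equation of `z_{s,j}` is the pure power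
`z_{s,j} ^ r_{j+1}` plus terms of the same degree that are heavier when variables are weighted by
level. Division by these equations reduces every polynomial to monomials with exponents below the
`r_{j+1}`. In bounded degree this is the invertibility of one matrix, hence it survives for generic
`q`. Evaluations at distinct solutions are independent functionals on the span of those monomials,
so there are at most `∏ r_{j+1} ^ r_j` solutions.

Lower bound (`exists_full_configuration`). Put `z_{s,j} = t ^ j y_{s,j}` and let `q_j` be `c_j`
times a suitable power of `t`. At `t = 0` the system becomes `y_{s,j} ^ r_{j+1} = c_j ∏ b,
(-y_{b,j-1})`, solved level by level by extracting roots. This gives the full number of nowhere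
vanishing solutions, with Jacobian triangular and invertible, so each deforms to small `t`. On one
level the coordinates are roots of one and the same number, and they coincide exactly when the same
root is chosen. Symmetry in the variables of a level makes coincidences persist, so non-degenerate
solutions correspond to choices injective on each level, counted by falling factorials.

The parameters reached this way are only Zariski dense. Chevalley's theorem
(`exists_generic_solvable`), applied to a system encoding the whole configuration of solutions,
makes the lower bound generic (`exists_generic_configuration`). -/

/-! ### Chevalley's theorem: from dense to generic solvability. -/

/-- A polynomial system with parameters over an algebraically closed field that is solvable for a
Zariski dense set of parameters is solvable for generic parameters. -/
theorem exists_generic_solvable {K κ τ : Type*} [Field K] [IsAlgClosed K] [Finite κ] [Finite τ]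
    (P : Set (MvPolynomial (κ ⊕ τ) K))
    (h : ∀ F : MvPolynomial κ K, F ≠ 0 → ∃ q : κ → K, eval q F ≠ 0 ∧
      ∃ x : τ → K, ∀ p ∈ P, eval (Sum.elim q x) p = 0) :
    ∃ F : MvPolynomial κ K, F ≠ 0 ∧ ∀ q : κ → K, eval q F ≠ 0 →
      ∃ x : τ → K, ∀ p ∈ P, eval (Sum.elim q x) p = 0 := by
  classical
  let I : Ideal (MvPolynomial (κ ⊕ τ) K) := Ideal.span P
  let f : MvPolynomial κ K →+* MvPolynomial (κ ⊕ τ) K ⧸ I :=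
    (Ideal.Quotient.mk I).comp (rename (Sum.inl : κ → κ ⊕ τ)).toRingHom
  have hft : f.FiniteType := by
    apply RingHom.FiniteType.of_comp_finiteType (f := (C : K →+* MvPolynomial κ K))
    have : f.comp C = algebraMap K (MvPolynomial (κ ⊕ τ) K ⧸ I) := by
      ext a
      simp [f]
      rfl
    rw [this, RingHom.finiteType_algebraMap]
    infer_instance
  -- A nonzero parameter polynomial in `I` would vanish at every solvable parameter, against
  -- density.
  have hinj : Function.Injective f := by
    rw [injective_iff_map_eq_zero]
    intro F hF
    by_contra hne
    obtain ⟨q, hq, x, hx⟩ := h F hne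
    have hmem : rename Sum.inl F ∈ I := Ideal.Quotient.eq_zero_iff_mem.1 hF
    have hle : I ≤ RingHom.ker (eval (Sum.elim q x)) := Ideal.span_le.2 fun p hp => hx p hp
    have h0 := hle hmem
    rw [RingHom.mem_ker, eval_rename] at h0
    exact hq (by simpa using h0)
  obtain ⟨S, hS⟩ := PrimeSpectrum.exists_constructibleSetData_iff.2
    (PrimeSpectrum.isConstructible_range_comap (RingHom.FinitePresentation.of_finiteType.1 hft))
  have hbot : (⊥ : PrimeSpectrum (MvPolynomial κ K)) ∈ Set.range (PrimeSpectrum.comap f) := by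
    obtain ⟨p, hp, hpf⟩ := Ideal.exists_comap_eq_of_mem_minimalPrimes_of_injective hinj
      (⊥ : Ideal _) (by rw [IsDomain.minimalPrimes_eq_singleton_bot]; rfl)
    exact ⟨⟨p, hp⟩, PrimeSpectrum.ext hpf⟩
  rw [← hS, PrimeSpectrum.ConstructibleSetData.toSet] at hbot
  obtain ⟨c, hcS, hc⟩ := Set.mem_iUnion₂.1 hbot
  -- The locally closed piece containing the generic point has no closed condition, so it is the
  -- basic open set of `c.f`.
  have hcf : c.f ≠ 0 := by
    intro h0
    exact hc.2 (by simp [h0])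
  have hcg : ∀ i, c.g i = 0 := by
    intro i
    have := hc.1 (Set.mem_range_self i)
    simpa using this
  refine ⟨c.f, hcf, fun q hq => ?_⟩
  have hmax : (vanishingIdeal K {q}).IsMaximal := inferInstance
  have hmem : (⟨vanishingIdeal K {q}, hmax.isPrime⟩ : PrimeSpectrum (MvPolynomial κ K)) ∈
      Set.range (PrimeSpectrum.comap f) := by
    rw [← hS]
    refine Set.mem_iUnion₂.2 ⟨c, hcS, ?_, ?_⟩
    · rintro _ ⟨i, rfl⟩
      rw [hcg]
      exact Ideal.zero_mem _
    · intro hm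
      have : c.f ∈ vanishingIdeal K {q} := hm rfl
      exact hq (by simpa [aeval_eq_eval] using this q rfl)
  obtain ⟨p, hp⟩ := hmem
  obtain ⟨m, hm, hpm⟩ := Ideal.exists_le_maximal p.asIdeal p.2.ne_top
  have hcm : (m.comap (Ideal.Quotient.mk I)).IsMaximal :=
    Ideal.comap_isMaximal_of_surjective _ Ideal.Quotient.mk_surjective
  obtain ⟨y, hy⟩ := isMaximal_iff_eq_vanishingIdeal_singleton.1 hcm
  -- The point `y` lies over `q` because `p` contracts to the maximal ideal of `q` and `m` contains
  -- `p`.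
  have hyq : ∀ j, y (Sum.inl j) = q j := by
    intro j
    have h1 : (X j - C (q j) : MvPolynomial κ K) ∈ vanishingIdeal K {q} := by
      rintro _ rfl
      simp
    have h2 : (X j - C (q j) : MvPolynomial κ K) ∈ p.asIdeal.comap f := by
      have : (PrimeSpectrum.comap f p).asIdeal = vanishingIdeal K {q} := by rw [hp]
      rw [← this] at h1
      exact h1
    have h3 : rename Sum.inl (X j - C (q j) : MvPolynomial κ K) ∈
        m.comap (Ideal.Quotient.mk I) := hpm h2
    rw [hy] at h3
    have := h3 y rfl
    simpa [sub_eq_zero] using this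
  refine ⟨fun i => y (Sum.inr i), fun r hr => ?_⟩
  have hyy : Sum.elim q (fun i => y (Sum.inr i)) = y := by
    ext (j | i)
    · simp [hyq]
    · rfl
  rw [hyy]
  have : r ∈ m.comap (Ideal.Quotient.mk I) := by
    rw [Ideal.mem_comap, Ideal.Quotient.eq_zero_iff_mem.2 (Ideal.subset_span hr)]
    exact Ideal.zero_mem _
  rw [hy] at this
  exact this y rfl

/-! ### Closed points and solutions: the Nullstellensatz. -/

/-- Closed points of an affine scheme of finite type over an algebraically closed field are the
solutions of its equations. -/
theorem encard_closedPoints_quotient {K σ ι : Type*} [Field K] [IsAlgClosed K] [Finite σ]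
    (f : ι → MvPolynomial σ K) :
    (closedPoints (PrimeSpectrum (MvPolynomial σ K ⧸ Ideal.span (Set.range f)))).encard =
      {z : σ → K | ∀ i, eval z (f i) = 0}.encard := by
  set I := Ideal.span (Set.range f) with hI
  symm
  have hle : ∀ z : σ → K, (∀ i, eval z (f i) = 0) → I ≤ vanishingIdeal K {z} := by
    intro z hz
    refine Ideal.span_le.2 ?_
    rintro _ ⟨i, rfl⟩ _ rfl
    exact hz i
  have hker : ∀ z : σ → K, (∀ i, eval z (f i) = 0) → ∀ p ∈ I, eval z p = 0 :=
    fun z hz p hp => hle z hz hp z rfl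
  have hmax : ∀ z : {z : σ → K | ∀ i, eval z (f i) = 0},
      (RingHom.ker (Ideal.Quotient.lift I (eval z.1) (hker z.1 z.2))).IsMaximal := fun z =>
    RingHom.ker_isMaximal_of_surjective _
      (Ideal.Quotient.lift_surjective_of_surjective _ _ fun a => ⟨C a, by simp⟩)
  let e : {z : σ → K | ∀ i, eval z (f i) = 0} →
      closedPoints (PrimeSpectrum (MvPolynomial σ K ⧸ I)) := fun z =>
    ⟨⟨_, (hmax z).isPrime⟩, (PrimeSpectrum.isClosed_singleton_iff_isMaximal _).2 (hmax z)⟩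
  refine Set.encard_congr (Equiv.ofBijective e ⟨?_, ?_⟩)
  · intro z w hzw
    have h1 : RingHom.ker (Ideal.Quotient.lift I (eval z.1) (hker z.1 z.2)) =
        RingHom.ker (Ideal.Quotient.lift I (eval w.1) (hker w.1 w.2)) :=
      congrArg (fun p => p.1.asIdeal) hzw
    refine Subtype.ext (funext fun i => ?_)
    have h2 : Ideal.Quotient.mk I (X i - C (z.1 i)) ∈
        RingHom.ker (Ideal.Quotient.lift I (eval z.1) (hker z.1 z.2)) := by
      rw [RingHom.mem_ker, Ideal.Quotient.lift_mk]
      simp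
    rw [h1, RingHom.mem_ker, Ideal.Quotient.lift_mk] at h2
    simpa [sub_eq_zero] using congrArg (- ·) h2
  · rintro ⟨p, hp⟩
    have hpm := (PrimeSpectrum.isClosed_singleton_iff_isMaximal _).1 hp
    have hcm : (p.asIdeal.comap (Ideal.Quotient.mk I)).IsMaximal :=
      Ideal.comap_isMaximal_of_surjective _ Ideal.Quotient.mk_surjective
    obtain ⟨y, hy⟩ := isMaximal_iff_eq_vanishingIdeal_singleton.1 hcm
    have hy0 : ∀ i, eval y (f i) = 0 := by
      intro i
      have : f i ∈ p.asIdeal.comap (Ideal.Quotient.mk I) := by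
        rw [Ideal.mem_comap,
          Ideal.Quotient.eq_zero_iff_mem.2 (Ideal.subset_span (Set.mem_range_self i))]
        exact Ideal.zero_mem _
      rw [hy] at this
      exact this y rfl
    refine ⟨⟨y, hy0⟩, Subtype.ext (PrimeSpectrum.ext ?_)⟩
    refine ((hmax ⟨y, hy0⟩).eq_of_le hpm.ne_top ?_)
    intro a ha
    obtain ⟨a, rfl⟩ := Ideal.Quotient.mk_surjective a
    rw [RingHom.mem_ker, Ideal.Quotient.lift_mk] at ha
    change a ∈ p.asIdeal.comap (Ideal.Quotient.mk I)
    rw [hy]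
    rintro _ rfl
    exact ha

theorem N_eq_encard_solutions (k : ℕ) (r : ℕ → ℕ) (q : Fin k → ℂ) :
    N k r q = (solutions k r q).encard :=
  encard_closedPoints_quotient (eqn k r q)

/-! ### Upper bound by weighted division. -/

section UpperBound

variable {R : Type*} [CommRing R] {σ : Type*}

/-- Polynomials of total degree at most `n` all of whose monomials have weight at least `b`. -/
noncomputable def boundedPart (R : Type*) [CommRing R] (w : σ → ℕ) (n b : ℕ) :
    Submodule R (MvPolynomial σ R) :=
  restrictSupport R {m | m.degree ≤ n ∧ b ≤ Finsupp.weight w m}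

theorem mul_mem_boundedPart {w : σ → ℕ} {n b n' b' : ℕ} {p p' : MvPolynomial σ R}
    (hp : p ∈ boundedPart R w n b) (hp' : p' ∈ boundedPart R w n' b') :
    p * p' ∈ boundedPart R w (n + n') (b + b') := by
  have h := Submodule.mul_mem_mul hp hp'
  rw [boundedPart, boundedPart, ← restrictSupport_add] at h
  refine restrictSupport_mono R ?_ h
  rintro _ ⟨m, hm, m', hm', rfl⟩
  exact ⟨by simpa using add_le_add hm.1 hm'.1, by simpa using add_le_add hm.2 hm'.2⟩

theorem monomial_mem_boundedPart {w : σ → ℕ} {n b : ℕ} {m : σ →₀ ℕ} (a : R) (h : m.degree ≤ n)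
    (h' : b ≤ Finsupp.weight w m) : monomial m a ∈ boundedPart R w n b :=
  (monomial_mem_restrictSupport _).2 (Or.inl ⟨h, h'⟩)

theorem X_mem_boundedPart {w : σ → ℕ} {b : ℕ} {i : σ} (h : b ≤ w i) :
    (X i : MvPolynomial σ R) ∈ boundedPart R w 1 b :=
  monomial_mem_boundedPart _ (by simp) (by simpa [Finsupp.weight_single] using h)

theorem X_pow_mem_boundedPart {w : σ → ℕ} {i : σ} (n : ℕ) :
    (X i ^ n : MvPolynomial σ R) ∈ boundedPart R w n (n * w i) := by
  rw [X_pow_eq_monomial]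
  exact monomial_mem_boundedPart _ (by simp) (by simp [Finsupp.weight_single])

theorem boundedPart_anti {w : σ → ℕ} {n b b' : ℕ} (h : b' ≤ b) :
    boundedPart R w n b ≤ boundedPart R w n b' :=
  restrictSupport_mono R fun _ hm => ⟨hm.1, h.trans hm.2⟩

theorem boundedPart_mono {w : σ → ℕ} {n n' b : ℕ} (h : n ≤ n') :
    boundedPart R w n b ≤ boundedPart R w n' b :=
  restrictSupport_mono R fun _ hm => ⟨hm.1.trans h, hm.2⟩

/-- A product of linear forms `X i - l a`, with `l a` heavier than `X i`, is `X i ^ n` up to heavier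
terms. -/
theorem prod_X_sub_sub_X_pow_mem {ι : Type*} {w : σ → ℕ} {i : σ} (l : ι → MvPolynomial σ R)
    (hl : ∀ a, l a ∈ boundedPart R w 1 (w i + 1)) (s : Finset ι) :
    ∏ a ∈ s, (X i - l a) - X i ^ s.card ∈ boundedPart R w s.card (s.card * w i + 1) := by
  classical
  induction s using Finset.induction_on with
  | empty => simp
  | insert a s has ih =>
    rw [Finset.prod_insert has, Finset.card_insert_of_notMem has]
    have h1 : X i - l a ∈ boundedPart R w 1 (w i) :=
      sub_mem (X_mem_boundedPart le_rfl) (boundedPart_anti (Nat.le_succ _) (hl a))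
    have e : (X i - l a) * ∏ a ∈ s, (X i - l a) - X i ^ (s.card + 1) =
        (∏ a ∈ s, (X i - l a) - X i ^ s.card) * (X i - l a) - X i ^ s.card * l a := by ring
    rw [e]
    refine sub_mem ?_ ?_
    · refine boundedPart_anti (le_of_eq (by ring)) (mul_mem_boundedPart ih h1)
    · refine boundedPart_anti (le_of_eq (by ring)) (mul_mem_boundedPart (X_pow_mem_boundedPart _) (hl a))

variable {K : Type*} [Field K]

/-- If the monomials in a set `B` span all polynomials modulo functions vanishing on `S`, then `S`
has at most as many points as `B` has elements. -/
theorem encard_le_of_sup_eq_top {B : Set (σ →₀ ℕ)} (hB : B.Finite) (S : Set (σ → K))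
    (I : Submodule K (MvPolynomial σ K)) (hI : ∀ p ∈ I, ∀ z ∈ S, eval z p = 0)
    (h : restrictSupport K B ⊔ I = ⊤) : S.encard ≤ B.encard := by
  have : Finite B := hB
  have : Module.Finite K (restrictSupport K B) := Module.Finite.of_basis (basisRestrictSupport K B)
  let ev : S → Module.Dual K (MvPolynomial σ K) := fun z => (aeval z.1).toLinearMap
  -- Dedekind: distinct multiplicative characters are linearly independent.
  have hev : LinearIndependent K ev := by
    have h1 := linearIndependent_monoidHom (MvPolynomial σ K) K
    have h2 : Function.Injective fun z : S => ((eval z.1 : MvPolynomial σ K →+* K) :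
        MvPolynomial σ K →* K) := by
      intro z z' hz
      refine Subtype.ext (funext fun i => ?_)
      simpa using DFunLike.congr_fun hz (X i)
    have h3 := h1.comp _ h2
    let toFn : Module.Dual K (MvPolynomial σ K) →ₗ[K] MvPolynomial σ K → K :=
      { toFun := fun ξ => ξ, map_add' := fun _ _ => rfl, map_smul' := fun _ _ => rfl }
    exact LinearIndependent.of_comp toFn h3
  have hI' : ∀ ξ ∈ Submodule.span K (Set.range ev), ∀ p ∈ I, ξ p = 0 := by
    intro ξ hξ p hp
    induction hξ using Submodule.span_induction with
    | mem x hx =>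
      obtain ⟨z, rfl⟩ := hx
      exact hI p hp z.1 z.2
    | zero => rfl
    | add x y _ _ hx hy => simp [hx, hy]
    | smul a x _ hx => simp [hx]
  -- A combination of evaluations already kills `I`; if it also kills the span of `B`, it is zero.
  have hres : LinearIndependent K ((restrictSupport K B).subtype.dualMap ∘ ev) := by
    refine hev.map (Submodule.disjoint_def.2 fun ξ hξ hk => ?_)
    refine LinearMap.ext fun p => ?_
    have hp : p ∈ restrictSupport K B ⊔ I := h ▸ Submodule.mem_top
    obtain ⟨v, hv, u, hu, rfl⟩ := Submodule.mem_sup.1 hp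
    rw [map_add, hI' ξ hξ u hu, add_zero]
    exact LinearMap.congr_fun hk ⟨v, hv⟩
  have hfin : Finite S := hres.finite
  have : Fintype S := Fintype.ofFinite _
  have : Fintype B := Fintype.ofFinite _
  have hle := hres.fintype_card_le_finrank
  rw [Subspace.dual_finrank_eq, Module.finrank_eq_card_basis (basisRestrictSupport K B)] at hle
  rw [Set.encard_eq_coe_toFinset_card, Set.encard_eq_coe_toFinset_card, Set.toFinset_card,
    Set.toFinset_card]
  exact_mod_cast hle

/-- Degree `e + 1` suffices: once a polynomial is reduced to the span of `B`, multiplying by one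
variable raises the degree to at most `e + 1`, where reduction is again available. -/
theorem restrictSupport_sup_eq_top {B : Set (σ →₀ ℕ)} (e : ℕ) (hBe : ∀ m ∈ B, m.degree ≤ e)
    (I : Ideal (MvPolynomial σ K))
    (h : ∀ m : σ →₀ ℕ, m.degree ≤ e + 1 →
      monomial m 1 ∈ restrictSupport K B ⊔ I.restrictScalars K) :
    restrictSupport K B ⊔ I.restrictScalars K = ⊤ := by
  refine Submodule.eq_top_iff'.2 fun p => ?_
  induction p using MvPolynomial.induction_on with
  | C a =>
    have := Submodule.smul_mem _ a (h 0 (by simp))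
    rwa [smul_monomial, smul_eq_mul, mul_one, ← C_apply] at this
  | add p q hp hq => exact add_mem hp hq
  | mul_X p i hp =>
    obtain ⟨v, hv, u, hu, rfl⟩ := Submodule.mem_sup.1 hp
    rw [add_mul]
    refine add_mem ?_ (Submodule.mem_sup_right (I.mul_mem_right _ hu))
    clear hp hu
    rw [restrictSupport_eq_span] at hv
    induction hv using Submodule.span_induction with
    | mem x hx =>
      obtain ⟨m, hm, rfl⟩ := hx
      have := h (m + Finsupp.single i 1) (by simpa using hBe m hm)
      simpa [X, monomial_mul] using this
    | zero => simp
    | add x y _ _ hx hy => rw [add_mul]; exact add_mem hx hy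
    | smul a x _ hx => rw [smul_mul_assoc]; exact Submodule.smul_mem _ a hx

/-- Division with degree bounds by polynomials that are pure powers up to heavier terms. -/
theorem exists_division [Fintype σ] (w d : σ → ℕ) (f : σ → MvPolynomial σ K)
    (hf : ∀ i, f i - X i ^ d i ∈ boundedPart K w (d i) (d i * w i + 1)) (n : ℕ) (m : σ →₀ ℕ)
    (hm : m.degree ≤ n) :
    ∃ v : MvPolynomial σ K, ∃ g : σ → MvPolynomial σ K,
      v ∈ restrictSupport K {m | (∀ i, m i < d i) ∧ m.degree ≤ n} ∧
      (∀ i, g i ∈ restrictSupport K {m | m.degree + d i ≤ n}) ∧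
      v + ∑ i, g i * f i = monomial m 1 := by
  classical
  let Ψ : (restrictSupport K {m : σ →₀ ℕ | (∀ i, m i < d i) ∧ m.degree ≤ n} ×
      ((i : σ) → restrictSupport K {m : σ →₀ ℕ | m.degree + d i ≤ n})) →ₗ[K] MvPolynomial σ K :=
    (Submodule.subtype _).coprod
      (∑ i, (LinearMap.mulRight K (f i)) ∘ₗ (Submodule.subtype _) ∘ₗ LinearMap.proj i)
  have hΨ : ∀ x, Ψ x = x.1.1 + ∑ i, (x.2 i).1 * f i := fun x => by simp [Ψ]
  obtain ⟨W, hW⟩ : ∃ W, ∀ i, w i ≤ W :=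
    ⟨∑ i, w i, fun i => Finset.single_le_sum (f := w) (fun _ _ => Nat.zero_le _) (Finset.mem_univ i)⟩
  have hwt : ∀ m : σ →₀ ℕ, m.degree ≤ n → Finsupp.weight w m ≤ n * W := by
    intro m hm
    calc Finsupp.weight w m = ∑ i, m i * w i := by
          rw [Finsupp.weight_apply, Finsupp.sum_fintype _ _ (by simp)]; simp
      _ ≤ ∑ i, m i * W := Finset.sum_le_sum fun i _ => Nat.mul_le_mul_left _ (hW i)
      _ = m.degree * W := by rw [← Finset.sum_mul, Finsupp.degree_eq_sum]
      _ ≤ n * W := Nat.mul_le_mul_right _ hm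
  -- Replacing `X i ^ d i` by heavier terms raises the weight without leaving degree at most `n`,
  -- where weights are bounded by `n * W`; the induction is on the remaining gap.
  have key : ∀ N, ∀ m : σ →₀ ℕ, m.degree ≤ n → n * W - Finsupp.weight w m = N →
      monomial m 1 ∈ LinearMap.range Ψ := by
    intro N
    induction N using Nat.strong_induction_on with
    | _ N ih =>
      intro m hm hN
      by_cases hmd : ∀ i, m i < d i
      · exact ⟨(⟨monomial m 1, (monomial_mem_restrictSupport _).2 (Or.inl ⟨hmd, hm⟩)⟩, 0), by
          simp [hΨ]⟩
      push Not at hmd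
      obtain ⟨i, hi⟩ := hmd
      obtain ⟨m', rfl⟩ : ∃ m', m = m' + Finsupp.single i (d i) :=
        ⟨m - Finsupp.single i (d i), (tsub_add_cancel_of_le (by simpa using hi)).symm⟩
      have hdeg : m'.degree + d i ≤ n := by simpa using hm
      have e : (monomial (m' + Finsupp.single i (d i)) 1 : MvPolynomial σ K) =
          monomial m' 1 * f i - monomial m' 1 * (f i - X i ^ d i) := by
        rw [X_pow_eq_monomial, mul_sub, monomial_mul]
        simp
      rw [e]
      refine sub_mem ?_ ?_
      · refine ⟨(0, Pi.single i ⟨monomial m' 1, (monomial_mem_restrictSupport _).2 (Or.inl hdeg)⟩), ?_⟩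
        rw [hΨ, Finset.sum_eq_single i]
        · simp
        · intro j _ hj
          simp [Pi.single_eq_of_ne hj]
        · simp
      · have h1 := mul_mem_boundedPart (monomial_mem_boundedPart (w := w) (1 : K) le_rfl le_rfl) (hf i)
          (p := monomial m' 1)
        rw [boundedPart, restrictSupport_eq_span] at h1
        refine Submodule.span_le.2 ?_ h1
        rintro _ ⟨μ, ⟨hμ1, hμ2⟩, rfl⟩
        have hμn := hμ1.trans hdeg
        refine ih _ ?_ μ hμn rfl
        have h3 := hwt μ hμn
        have h4 : Finsupp.weight w (m' + Finsupp.single i (d i)) =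
          Finsupp.weight w m' + d i * w i := by simp [Finsupp.weight_single]
        omega
  obtain ⟨x, hx⟩ := key _ m hm rfl
  exact ⟨x.1.1, fun i => (x.2 i).1, x.1.2, fun i => (x.2 i).2, by rw [← hΨ, hx]⟩

theorem finite_exponents_lt [Fintype σ] (d : σ → ℕ) :
    {m : σ →₀ ℕ | ∀ i, m i < d i}.Finite ∧
      {m : σ →₀ ℕ | ∀ i, m i < d i}.encard = ((∏ i, d i : ℕ) : ℕ∞) := by
  let e : {m : σ →₀ ℕ | ∀ i, m i < d i} ≃ ((i : σ) → Fin (d i)) :=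
    { toFun := fun m i => ⟨m.1 i, m.2 i⟩
      invFun := fun g => ⟨Finsupp.equivFunOnFinite.symm fun i => (g i : ℕ), fun i => by simp⟩
      left_inv := fun m => by ext; simp
      right_inv := fun g => by ext; simp }
  classical
  have hfin : Finite {m : σ →₀ ℕ | ∀ i, m i < d i} := Finite.of_equiv _ e.symm
  refine ⟨hfin, ?_⟩
  rw [Set.encard, ENat.card_congr e, ENat.card_eq_coe_fintype_card]
  simp

/-- A square polynomial system depending polynomially on parameters whose specialization at `0` has
the pure powers `X i ^ d i` as initial terms has at most `∏ i, d i` solutions for generic values of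
the parameters. -/
theorem exists_generic_encard_le [Fintype σ] {κ : Type*} (w d : σ → ℕ)
    (f : σ → MvPolynomial σ (MvPolynomial κ K))
    (hdeg : ∀ i, f i ∈ restrictSupport (MvPolynomial κ K) {m | m.degree ≤ d i})
    (hf : ∀ i, map (eval 0) (f i) - X i ^ d i ∈ boundedPart K w (d i) (d i * w i + 1)) :
    ∃ F : MvPolynomial κ K, F ≠ 0 ∧ ∀ q : κ → K, eval q F ≠ 0 →
      {z : σ → K | ∀ i, eval z (map (eval q) (f i)) = 0}.encard ≤ ((∏ i, d i : ℕ) : ℕ∞) := by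
  classical
  obtain ⟨hBfin, hBcard⟩ := finite_exponents_lt d
  set B := {m : σ →₀ ℕ | ∀ i, m i < d i} with hB
  -- Elements of `B` have degree at most `∑ i, d i`; the extra `1` allows multiplication by a
  -- variable.
  set n := ∑ i, d i + 1 with hn
  let T := {m : σ →₀ ℕ | m.degree ≤ n}
  have : Fintype T := (Finsupp.finite_of_degree_le n).fintype
  choose v g hv hg hvg using fun m : T => exists_division w d (fun i => map (eval 0) (f i)) hf n m.1 m.2
  -- The quotients and remainders found at parameter `0` are frozen; only `f i` varies.
  let p : T → MvPolynomial σ (MvPolynomial κ K) := fun m =>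
    map C (v m) + ∑ i, map C (g m i) * f i
  have hmapC : ∀ (q : κ → K) (u : MvPolynomial σ K), map (eval q) (map C u) = u := by
    intro q u
    rw [map_map]
    have : (eval q).comp (C : K →+* MvPolynomial κ K) = RingHom.id K := by ext; simp
    rw [this, map_id]
  have hpq : ∀ q m, map (eval q) (p m) = v m + ∑ i, g m i * map (eval q) (f i) := by
    intro q m
    simp only [p, map_add, map_sum, map_mul, hmapC]
  have hsuppC : ∀ (s : Set (σ →₀ ℕ)) (u : MvPolynomial σ K), u ∈ restrictSupport K s →
      map C u ∈ restrictSupport (MvPolynomial κ K) s := fun s u hu =>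
    (mem_restrictSupport_iff _).2
      (Set.Subset.trans (support_map_subset _ _) ((mem_restrictSupport_iff _).1 hu))
  have hpsupp : ∀ m, p m ∈ restrictSupport (MvPolynomial κ K) T := by
    intro m
    refine add_mem (restrictSupport_mono _ (fun _ h => h.2) (hsuppC _ _ (hv m))) ?_
    refine sum_mem fun i _ => ?_
    have h := Submodule.mul_mem_mul (hsuppC _ _ (hg m i)) (hdeg i)
    rw [← restrictSupport_add] at h
    refine restrictSupport_mono _ ?_ h
    rintro _ ⟨a, ha, b, hb, rfl⟩
    have h1 : a.degree + d i ≤ n := ha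
    have h2 : b.degree ≤ d i := hb
    change (a + b).degree ≤ n
    rw [map_add]
    omega
  -- At parameter `0` division returns each monomial, so `M` becomes the identity and `M.det` is
  -- nonzero. Where the determinant does not vanish, the specialized `p m` span all monomials of
  -- degree at most `n`.
  let M : Matrix T T (MvPolynomial κ K) := fun m m' => coeff m'.1 (p m)
  have hM : ∀ q m m', eval q (M m m') = coeff m'.1 (map (eval q) (p m)) := fun q m m' => by
    rw [coeff_map]
  refine ⟨M.det, ?_, fun q hq => ?_⟩
  · intro h0
    have h1 : eval 0 M.det = 1 := by
      rw [RingHom.map_det]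
      have : (eval (0 : κ → K)).mapMatrix M = 1 := by
        ext m m'
        rw [RingHom.mapMatrix_apply, Matrix.map_apply, hM, hpq, hvg, coeff_monomial,
          Matrix.one_apply]
        simp [Subtype.ext_iff]
      rw [this, Matrix.det_one]
    rw [h0, map_zero] at h1
    exact zero_ne_one h1
  · let I := Ideal.span (Set.range fun i => map (eval q) (f i))
    rw [← hBcard]
    refine encard_le_of_sup_eq_top hBfin _ (I.restrictScalars K) ?_
      (restrictSupport_sup_eq_top (∑ i, d i) ?_ I ?_)
    · intro u hu z hz
      have hle : I ≤ RingHom.ker (eval z) := by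
        refine Ideal.span_le.2 ?_
        rintro _ ⟨i, rfl⟩
        exact hz i
      exact hle hu
    · intro m hm
      rw [Finsupp.degree_eq_sum]
      exact Finset.sum_le_sum fun i _ => (hm i).le
    · intro m hm
      let Mq := (eval q).mapMatrix M
      have hdet : IsUnit Mq.det := by
        rw [← RingHom.map_det]
        exact hq.isUnit
      have hexp : ∀ a : T, map (eval q) (p a) = ∑ b : T, Mq a b • monomial b.1 1 := by
        intro a
        ext μ
        rw [coeff_sum]
        simp only [coeff_smul, coeff_monomial, smul_eq_mul, mul_ite, mul_one, mul_zero]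
        by_cases hμ : μ ∈ T
        · rw [Finset.sum_eq_single ⟨μ, hμ⟩]
          · simp only [if_true]
            exact (hM q a ⟨μ, hμ⟩).symm
          · intro b _ hb
            rw [if_neg fun h => hb (Subtype.ext h)]
          · simp
        · rw [Finset.sum_eq_zero]
          · by_contra hne
            rw [coeff_map] at hne
            refine hμ ((mem_restrictSupport_iff _).1 (hpsupp a) (mem_support_iff.2 fun h0 => ?_))
            rw [h0, map_zero] at hne
            exact hne rfl
          · intro b _
            rw [if_neg fun h : b.1 = μ => hμ (h ▸ b.2)]
      have hinv : (monomial m 1 : MvPolynomial σ K) =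
          ∑ a : T, Mq⁻¹ ⟨m, hm⟩ a • map (eval q) (p a) := by
        simp only [hexp, Finset.smul_sum, smul_smul]
        rw [Finset.sum_comm]
        simp only [← Finset.sum_smul, ← Matrix.mul_apply, Matrix.nonsing_inv_mul _ hdet]
        rw [Finset.sum_eq_single ⟨m, hm⟩]
        · simp
        · intro b _ hb
          rw [Matrix.one_apply_ne hb.symm, zero_smul]
        · simp
      rw [hinv]
      refine sum_mem fun a _ => Submodule.smul_mem _ _ ?_
      rw [hpq]
      refine add_mem (Submodule.mem_sup_left (restrictSupport_mono _ (fun _ h => h.1) (hv a)))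
        (Submodule.mem_sup_right (I.sum_mem fun i _ => I.mul_mem_left _ ?_))
      exact Ideal.subset_span (Set.mem_range_self i)

end UpperBound

/-! ### The upper bound for the Bethe system. -/

theorem prod_mem_boundedPart {R σ ι : Type*} [CommRing R] {w : σ → ℕ} (f : ι → MvPolynomial σ R)
    (s : Finset ι) (hf : ∀ a ∈ s, f a ∈ boundedPart R w 1 0) :
    ∏ a ∈ s, f a ∈ boundedPart R w s.card 0 := by
  classical
  induction s using Finset.induction_on with
  | empty => exact monomial_mem_boundedPart 1 (by simp) (by simp)
  | insert a s has ih =>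
    rw [Finset.prod_insert has, Finset.card_insert_of_notMem has, add_comm]
    exact mul_mem_boundedPart (hf a (by simp)) (ih fun b hb => hf b (by simp [hb]))

/-- The system with the parameters `q` as indeterminates. -/
noncomputable def genericEqn (k : ℕ) (r : ℕ → ℕ) (i : Idx k r) :
    MvPolynomial (Idx k r) (MvPolynomial (Fin k) ℂ) :=
  ∏ a : Fin (r (i.1 + 2)), (X i - map C (levelVar k r (i.1 + 2) a))
    - C (X i.1) * ∏ b : Fin (r i.1), (X i - map C (levelVar k r i.1 b))

theorem map_genericEqn (k : ℕ) (r : ℕ → ℕ) (q : Fin k → ℂ) (i : Idx k r) :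
    map (eval q) (genericEqn k r i) = eqn k r q i := by
  have h : (eval q).comp (C : ℂ →+* MvPolynomial (Fin k) ℂ) = RingHom.id ℂ := by ext; simp
  simp only [genericEqn, eqn, map_sub, map_mul, map_prod, map_X, map_C, eval_X, map_map, h, map_id]

/-- The weight is the zero-based level, so level `j` has weight `j - 1`; this makes the next level
strictly heavier in each equation. -/
theorem levelVar_mem_boundedPart (k : ℕ) (r : ℕ → ℕ) (j b : ℕ) (a : Fin (r j)) (hb : b + 1 ≤ j) :
    levelVar k r j a ∈ boundedPart ℂ (fun i : Idx k r => (i.1 : ℕ)) 1 b := by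
  cases j with
  | zero => exact Submodule.zero_mem _
  | succ j =>
    rw [levelVar]
    split_ifs with h
    · exact X_mem_boundedPart (by simpa using hb)
    · exact Submodule.zero_mem _

theorem map_levelVar_mem_boundedPart (k : ℕ) (r : ℕ → ℕ) (j : ℕ) (a : Fin (r j)) :
    map C (levelVar k r j a) ∈
      boundedPart (MvPolynomial (Fin k) ℂ) (fun i : Idx k r => (i.1 : ℕ)) 1 0 := by
  cases j with
  | zero => simp [levelVar]
  | succ j =>
    rw [levelVar]
    split_ifs with h
    · rw [map_X]
      exact X_mem_boundedPart (Nat.zero_le _)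
    · simp

/-- For generic parameters the number of solutions is at most the Bézout number. -/
theorem exists_generic_encard_solutions_le (k : ℕ) (r : ℕ → ℕ)
    (hr : ∀ j < k, r j ≤ r (j + 2)) :
    ∃ F : MvPolynomial (Fin k) ℂ, F ≠ 0 ∧ ∀ q, eval q F ≠ 0 →
      (solutions k r q).encard ≤ ((∏ i : Idx k r, r (i.1 + 2) : ℕ) : ℕ∞) := by
  have key := exists_generic_encard_le (K := ℂ) (fun i : Idx k r => (i.1 : ℕ))
    (fun i : Idx k r => r (i.1 + 2)) (genericEqn k r) ?_ ?_
  · simp only [map_genericEqn] at key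
    exact key
  · intro i
    have hprod : ∀ j, ∏ a : Fin (r j), (X i - map C (levelVar k r j a)) ∈
        boundedPart (MvPolynomial (Fin k) ℂ) (fun i : Idx k r => (i.1 : ℕ)) (r j) 0 := by
      intro j
      have := prod_mem_boundedPart (fun a : Fin (r j) => X i - map C (levelVar k r j a))
        Finset.univ fun a _ => sub_mem (X_mem_boundedPart (Nat.zero_le _))
          (map_levelVar_mem_boundedPart k r j a)
      simpa using this
    refine restrictSupport_mono _ (fun m hm => hm.1) (sub_mem (hprod _) ?_)
    rw [C_mul']
    exact Submodule.smul_mem _ _ (boundedPart_mono (hr _ i.1.2) (hprod _))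
  · intro i
    have := prod_X_sub_sub_X_pow_mem (w := fun i : Idx k r => (i.1 : ℕ)) (i := i)
      (levelVar k r (i.1 + 2)) (fun a => levelVar_mem_boundedPart k r _ _ a le_rfl) Finset.univ
    rw [map_genericEqn, eqn]
    simpa using this

/-! ### Rescaling and deformation from `t = 0`. -/

/-- The value of `levelVar k r j a` at the point `y`. -/
def level {k : ℕ} {r : ℕ → ℕ} (y : Idx k r → ℂ) : (j : ℕ) → Fin (r j) → ℂ
  | 0, _ => 0
  | j + 1, a => if h : j < k then y ⟨⟨j, h⟩, a⟩ else 0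

theorem eval_levelVar {k : ℕ} {r : ℕ → ℕ} (y : Idx k r → ℂ) (j : ℕ) (a : Fin (r j)) :
    eval y (levelVar k r j a) = level y j a := by
  cases j with
  | zero => simp [levelVar, level]
  | succ j =>
    rw [levelVar, level]
    split_ifs <;> simp

theorem eval_eqn {k : ℕ} {r : ℕ → ℕ} (q : Fin k → ℂ) (y : Idx k r → ℂ) (i : Idx k r) :
    eval y (eqn k r q i) = ∏ a : Fin (r (i.1 + 2)), (y i - level y (i.1 + 2) a)
      - q i.1 * ∏ b : Fin (r i.1), (y i - level y i.1 b) := by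
  simp [eqn, eval_levelVar]

/-- The system in the coordinates `y_{s,j} = t ^ (-j) z_{s,j}`, for suitably rescaled parameters. -/
def scaledEqn {k : ℕ} {r : ℕ → ℕ} (c : Fin k → ℂ) (t : ℂ) (y : Idx k r → ℂ) (i : Idx k r) : ℂ :=
  ∏ a : Fin (r (i.1 + 2)), (y i - t * level y (i.1 + 2) a)
    - c i.1 * ∏ b : Fin (r i.1), (t * y i - level y i.1 b)

/-- The rescaled parameters. -/
def scaledParam {k : ℕ} (r : ℕ → ℕ) (c : Fin k → ℂ) (t : ℂ) (j : Fin k) : ℂ :=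
  c j * t ^ ((j + 1) * r (j + 2) - j * r j)

theorem level_scale {k : ℕ} {r : ℕ → ℕ} (t : ℂ) (y : Idx k r → ℂ) (j : ℕ) (a : Fin (r j)) :
    level (fun i => t ^ (i.1 + 1 : ℕ) * y i) j a = t ^ j * level y j a := by
  cases j with
  | zero => simp [level]
  | succ j =>
    rw [level, level]
    split_ifs <;> simp

/-- The first product contributes `t ^ ((j + 1) * r (j + 2))` and the second `t ^ (j * r j)`; the
exponent in `scaledParam` is the difference. The hypothesis `hr` keeps this natural subtraction from
truncating. -/
theorem eval_eqn_scale {k : ℕ} {r : ℕ → ℕ} (hr : ∀ j < k, r j ≤ r (j + 2)) (c : Fin k → ℂ) (t : ℂ)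
    (y : Idx k r → ℂ) (i : Idx k r) :
    eval (fun i => t ^ (i.1 + 1 : ℕ) * y i) (eqn k r (scaledParam r c t) i) =
      t ^ ((i.1 + 1) * r (i.1 + 2)) * scaledEqn c t y i := by
  obtain ⟨e, he⟩ : ∃ e, (i.1 + 1) * r (i.1 + 2) = e + i.1 * r i.1 :=
    ⟨_, (Nat.sub_add_cancel (Nat.mul_le_mul (Nat.le_succ _) (hr _ i.1.2))).symm⟩
  rw [eval_eqn, scaledEqn, scaledParam]
  simp only [level_scale]
  have h1 : ∀ a, t ^ (i.1 + 1 : ℕ) * y i - t ^ (i.1 + 2 : ℕ) * level y (i.1 + 2) a =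
      t ^ (i.1 + 1 : ℕ) * (y i - t * level y (i.1 + 2) a) := fun a => by ring
  have h2 : ∀ b, t ^ (i.1 + 1 : ℕ) * y i - t ^ (i.1 : ℕ) * level y i.1 b =
      t ^ (i.1 : ℕ) * (t * y i - level y i.1 b) := fun b => by ring
  simp only [h1, h2, Finset.prod_mul_distrib, Finset.prod_const, Finset.card_univ,
    Fintype.card_fin, ← pow_mul]
  rw [he, Nat.add_sub_cancel]
  ring

theorem contDiff_level {k : ℕ} {r : ℕ → ℕ} (j : ℕ) (a : Fin (r j)) :
    ContDiff ℂ 1 fun x : ℂ × (Idx k r → ℂ) => level x.2 j a := by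
  cases j with
  | zero => exact contDiff_const
  | succ j =>
    simp only [level]
    split_ifs
    · fun_prop
    · exact contDiff_const

theorem contDiff_scaledEqn {k : ℕ} {r : ℕ → ℕ} (c : Fin k → ℂ) :
    ContDiff ℂ 1 fun x : ℂ × (Idx k r → ℂ) => (x.1, scaledEqn c x.1 x.2) := by
  refine contDiff_fst.prodMk (contDiff_pi.2 fun i => ?_)
  unfold scaledEqn
  have := contDiff_level (k := k) (r := r)
  refine ContDiff.sub (contDiff_prod fun a _ => ?_) (contDiff_const.mul (contDiff_prod fun b _ => ?_))
  · exact ContDiff.sub (by fun_prop) (contDiff_fst.mul (this _ a))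
  · exact ContDiff.sub (by fun_prop) (this _ b)

/-- At `t = 0` an equation involves only its own variable and the level below, so the Jacobian is
triangular by level, with diagonal entries `r (j + 2) * y i ^ (r (j + 2) - 1)`, nonzero since `y i ≠
0`. -/
theorem injective_fderiv_scaledEqn {k : ℕ} {r : ℕ → ℕ} (hpos : ∀ j < k, 0 < r (j + 2))
    (c : Fin k → ℂ) (y : Idx k r → ℂ) (hy : ∀ i, y i ≠ 0) :
    Function.Injective
      (fderiv ℂ (fun x : ℂ × (Idx k r → ℂ) => (x.1, scaledEqn c x.1 x.2)) (0, y)) := by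
  rw [injective_iff_map_eq_zero]
  rintro ⟨s, η⟩ hη
  set Φ := fun x : ℂ × (Idx k r → ℂ) => (x.1, scaledEqn c x.1 x.2) with hΦ
  have hd : HasFDerivAt Φ (fderiv ℂ Φ (0, y)) (0, y) :=
    ((contDiff_scaledEqn c).differentiable one_ne_zero _).hasFDerivAt
  have hline : HasDerivAt (fun u : ℂ => ((0, y) + u • (s, η) : ℂ × (Idx k r → ℂ))) (s, η) 0 := by
    simpa using ((hasDerivAt_id (0 : ℂ)).smul_const (s, η)).const_add (0, y)
  have hcomp : HasDerivAt (fun u : ℂ => Φ ((0, y) + u • (s, η))) 0 0 := by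
    have := HasFDerivAt.comp_hasDerivAt (x := (0 : ℂ)) (f := fun u : ℂ => (0, y) + u • (s, η))
      (l := Φ) (l' := fderiv ℂ Φ (0, y)) (f' := (s, η)) (by simpa using hd) hline
    rwa [hη] at this
  have hs : s = 0 := by
    have h1 : HasDerivAt (fun u : ℂ => (Φ ((0, y) + u • (s, η))).1) 0 0 := hcomp.fst
    simp only [hΦ, Prod.fst_add, Prod.smul_fst, smul_eq_mul, zero_add] at h1
    have h2 : HasDerivAt (fun u : ℂ => u * s) s 0 := by
      simpa using (hasDerivAt_id (0 : ℂ)).mul_const s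
    exact h2.unique h1
  subst hs
  have hlev : ∀ j, ∀ a : Fin (r j), level η j a = 0 := by
    intro j
    induction j with
    | zero => intro a; rfl
    | succ j ih =>
      intro a
      rw [level]
      split_ifs with hj
      swap; · rfl
      set i : Idx k r := ⟨⟨j, hj⟩, a⟩ with hi
      -- By induction the direction `η` vanishes on the level below, so the lower product is
      -- constant along the line.
      have hconst : ∀ (u : ℂ) (b : Fin (r j)), level (y + u • η) j b = level y j b := by
        intro u b
        have hb := ih b
        cases j with
        | zero => rfl
        | succ j =>
          rw [level] at hb ⊢
          rw [level]
          split_ifs at hb ⊢ with h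
          · simp [hb]
          · rfl
      have h1 : HasDerivAt (fun u : ℂ => (y i + u * η i) ^ r (j + 2) -
          c ⟨j, hj⟩ * ∏ b : Fin (r j), (0 - level y j b)) 0 0 := by
        have := (hasDerivAt_pi.1 hcomp.snd) i
        refine this.congr_of_eventuallyEq (Filter.Eventually.of_forall fun u => ?_)
        simp only [hΦ, scaledEqn, Prod.fst_add, Prod.snd_add, Prod.smul_fst, Prod.smul_snd,
          mul_zero, add_zero, zero_mul, sub_zero, Pi.add_apply, Pi.smul_apply, smul_eq_mul, hi,
          hconst, Finset.prod_const, Finset.card_univ, Fintype.card_fin]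
      have h2 : HasDerivAt (fun u : ℂ => (y i + u * η i) ^ r (j + 2) -
          c ⟨j, hj⟩ * ∏ b : Fin (r j), (0 - level y j b))
          (r (j + 2) * y i ^ (r (j + 2) - 1) * η i) 0 := by
        have := ((((hasDerivAt_id (0 : ℂ)).mul_const (η i)).const_add (y i)).pow (r (j + 2))).sub_const
          (c ⟨j, hj⟩ * ∏ b : Fin (r j), (0 - level y j b))
        simpa using this
      have h3 := h2.unique h1
      have h4 : (r (j + 2) : ℂ) ≠ 0 := by exact_mod_cast (hpos j hj).ne'
      simpa [h4, hy i] using h3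
  refine Prod.ext rfl (funext fun i => ?_)
  have := hlev (i.1 + 1) i.2
  simpa [level] using this

theorem prod_level_perm {k : ℕ} {r : ℕ → ℕ} (ρ : (j : Fin k) → Equiv.Perm (Fin (r (j + 1))))
    (y : Idx k r → ℂ) (g : ℂ → ℂ) (j : ℕ) :
    ∏ a, g (level (y ∘ Equiv.sigmaCongrRight ρ) j a) = ∏ a, g (level y j a) := by
  cases j with
  | zero => rfl
  | succ j =>
    simp only [level]
    split_ifs with h
    · exact Equiv.prod_comp (ρ ⟨j, h⟩) fun a => g (y ⟨⟨j, h⟩, a⟩)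
    · rfl

/-- The system is symmetric under permutations of the variables of each level. -/
theorem scaledEqn_perm {k : ℕ} {r : ℕ → ℕ} (ρ : (j : Fin k) → Equiv.Perm (Fin (r (j + 1))))
    (c : Fin k → ℂ) (t : ℂ) (y : Idx k r → ℂ) (i : Idx k r) :
    scaledEqn c t (y ∘ Equiv.sigmaCongrRight ρ) i = scaledEqn c t y (Equiv.sigmaCongrRight ρ i) := by
  unfold scaledEqn
  rw [prod_level_perm ρ y (fun x => (y ∘ Equiv.sigmaCongrRight ρ) i - t * x),
    prod_level_perm ρ y (fun x => t * (y ∘ Equiv.sigmaCongrRight ρ) i - x)]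
  rfl

open Filter Topology

/-- A nowhere vanishing solution of the limit system deforms to solutions of the system for small
`t`, and coincidences among its coordinates of the same level persist. -/
theorem eventually_exists_scaledEqn_eq_zero {k : ℕ} {r : ℕ → ℕ} (hpos : ∀ j < k, 0 < r (j + 2))
    (c : Fin k → ℂ) (y : Idx k r → ℂ) (hy : ∀ i, y i ≠ 0) (hy0 : ∀ i, scaledEqn c 0 y i = 0)
    {U : Set (Idx k r → ℂ)} (hU : U ∈ 𝓝 y) :
    ∀ᶠ t in 𝓝 (0 : ℂ), ∃ y' ∈ U, (∀ i, scaledEqn c t y' i = 0) ∧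
      ∀ (j : Fin k) (s u : Fin (r (j + 1))), y ⟨j, s⟩ = y ⟨j, u⟩ → y' ⟨j, s⟩ = y' ⟨j, u⟩ := by
  classical
  set Φ := fun x : ℂ × (Idx k r → ℂ) => (x.1, scaledEqn c x.1 x.2) with hΦ
  have hΦ0 : Φ (0, y) = (0, 0) := Prod.ext rfl (funext hy0)
  let L : (ℂ × (Idx k r → ℂ)) ≃L[ℂ] (ℂ × (Idx k r → ℂ)) :=
    (LinearEquiv.ofInjectiveEndo (fderiv ℂ Φ (0, y)).toLinearMap
      (injective_fderiv_scaledEqn hpos c y hy)).toContinuousLinearEquiv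
  have hL : (L : (ℂ × (Idx k r → ℂ)) →L[ℂ] (ℂ × (Idx k r → ℂ))) = fderiv ℂ Φ (0, y) := by
    ext x <;> rfl
  have hd : HasStrictFDerivAt Φ (L : (ℂ × (Idx k r → ℂ)) →L[ℂ] (ℂ × (Idx k r → ℂ))) (0, y) := by
    rw [hL]
    exact ((contDiff_scaledEqn c).contDiffAt).hasStrictFDerivAt one_ne_zero
  let e := hd.toOpenPartialHomeomorph Φ
  have hsrc : e.source ∈ 𝓝 ((0 : ℂ), y) := e.open_source.mem_nhds hd.mem_toOpenPartialHomeomorph_source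
  -- Swapping two variables equal at `y` fixes `y`, so it sends a nearby solution to another one in
  -- the domain of local injectivity; the two must agree.
  let π (j : Fin k) (s u : Fin (r (j + 1))) : Equiv.Perm (Idx k r) :=
    Equiv.sigmaCongrRight (Pi.mulSingle (M := fun j : Fin k => Equiv.Perm (Fin (r (j + 1)))) j (Equiv.swap s u))
  have hπ : ∀ j s u, y ⟨j, s⟩ = y ⟨j, u⟩ → y ∘ π j s u = y := by
    intro j s u h
    ext ⟨j', a⟩
    by_cases hj : j' = j
    · subst hj
      simp only [π, Function.comp_apply, Equiv.sigmaCongrRight_apply, Pi.mulSingle_eq_same]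
      rcases eq_or_ne a s with rfl | has
      · simp [h]
      rcases eq_or_ne a u with rfl | hau
      · simp [h]
      · rw [Equiv.swap_apply_of_ne_of_ne has hau]
    · simp [π, Pi.mulSingle_eq_of_ne hj]
  have hnhds : ∀ᶠ x in 𝓝 ((0 : ℂ), y), x.2 ∈ U ∧ x ∈ e.source ∧
      ∀ (j : Fin k) (s u : Fin (r (j + 1))), y ⟨j, s⟩ = y ⟨j, u⟩ →
        (x.1, x.2 ∘ π j s u) ∈ e.source := by
    refine ((continuous_snd.tendsto ((0 : ℂ), y)).eventually hU).and (Filter.Eventually.and hsrc ?_)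
    rw [eventually_all]; intro j
    rw [eventually_all]; intro s
    rw [eventually_all]; intro u
    by_cases h : y ⟨j, s⟩ = y ⟨j, u⟩
    · have hc : Continuous fun x : ℂ × (Idx k r → ℂ) => (x.1, x.2 ∘ π j s u) := by
        refine continuous_fst.prodMk (continuous_pi fun i => ?_)
        exact (continuous_apply _).comp continuous_snd
      have := hc.tendsto (0, y)
      simp only [hπ j s u h] at this
      filter_upwards [this.eventually hsrc] with x hx _ using hx
    · exact Eventually.of_forall fun x h' => absurd h' h
  have himg : Φ '' {x | x.2 ∈ U ∧ x ∈ e.source ∧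
      ∀ (j : Fin k) (s u : Fin (r (j + 1))), y ⟨j, s⟩ = y ⟨j, u⟩ →
        (x.1, x.2 ∘ π j s u) ∈ e.source} ∈ 𝓝 ((0 : ℂ), (0 : Idx k r → ℂ)) := by
    rw [← hΦ0, ← hd.map_nhds_eq_of_equiv]
    exact image_mem_map hnhds
  have hcont : Tendsto (fun t : ℂ => (t, (0 : Idx k r → ℂ))) (𝓝 0) (𝓝 (0, 0)) :=
    (continuous_id.prodMk continuous_const).tendsto 0
  filter_upwards [hcont.eventually himg] with t ht
  obtain ⟨⟨t', y'⟩, ⟨hyU, hys, hyp⟩, hx⟩ := ht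
  obtain rfl : t' = t := congrArg Prod.fst hx
  have hz : ∀ i, scaledEqn c t' y' i = 0 := fun i => congrFun (congrArg Prod.snd hx) i
  refine ⟨y', hyU, hz, fun j s u h => ?_⟩
  have heq : (t', y' ∘ π j s u) = (t', y') := by
    refine e.injOn (hyp j s u h) hys ?_
    change Φ _ = Φ _
    refine Prod.ext rfl (funext fun i => ?_)
    simp only [hΦ]
    rw [scaledEqn_perm, hz, hz]
  have := congrFun (congrArg Prod.snd heq) ⟨j, s⟩
  simpa [π] using this.symm

/-! ### Genericity of configurations of solutions. -/

/-- If for a Zariski dense set of parameters a polynomial system has distinct solutions indexed by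
`Ω`, with a polynomial `W` nonvanishing exactly at those indexed by `Λ`, then this holds for generic
parameters. -/
theorem exists_generic_configuration {K κ σ ι Ω : Type*} [Field K] [IsAlgClosed K] [Finite κ]
    [Fintype σ] [Finite Ω] (f : ι → MvPolynomial σ (MvPolynomial κ K)) (W : MvPolynomial σ K)
    (Λ : Set Ω)
    (h : ∀ F : MvPolynomial κ K, F ≠ 0 → ∃ q : κ → K, eval q F ≠ 0 ∧ ∃ Z : Ω → σ → K,
      Function.Injective Z ∧ (∀ α i, eval (Z α) (map (eval q) (f i)) = 0) ∧
      ∀ α, eval (Z α) W ≠ 0 ↔ α ∈ Λ) :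
    ∃ F : MvPolynomial κ K, F ≠ 0 ∧ ∀ q : κ → K, eval q F ≠ 0 → ∃ Z : Ω → σ → K,
      Function.Injective Z ∧ (∀ α i, eval (Z α) (map (eval q) (f i)) = 0) ∧
      ∀ α, eval (Z α) W ≠ 0 ↔ α ∈ Λ := by
  classical
  -- Rabinowitsch trick: the unknowns are the points, multipliers witnessing that two points differ,
  -- and inverses of `W` at the points indexed by `Λ`. Inequalities thus become equations.
  let τ := (Ω × σ) ⊕ (Ω × Ω × σ) ⊕ Ω
  let zv : Ω → σ → MvPolynomial (κ ⊕ τ) K := fun α i => X (Sum.inr (Sum.inl (α, i)))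
  let uv : Ω → Ω → σ → MvPolynomial (κ ⊕ τ) K := fun α β i => X (Sum.inr (Sum.inr (Sum.inl (α, β, i))))
  let vv : Ω → MvPolynomial (κ ⊕ τ) K := fun α => X (Sum.inr (Sum.inr (Sum.inr α)))
  let sys : Ω → ι → MvPolynomial (κ ⊕ τ) K := fun α i =>
    eval₂Hom (rename Sum.inl).toRingHom (zv α) (f i)
  let sep : Ω → Ω → MvPolynomial (κ ⊕ τ) K := fun α β =>
    ∑ i, uv α β i * (zv α i - zv β i) - 1
  let Wv : Ω → MvPolynomial (κ ⊕ τ) K := fun α => aeval (zv α) W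
  let P : Set (MvPolynomial (κ ⊕ τ) K) :=
    {p | (∃ α i, p = sys α i) ∨ (∃ α β, α ≠ β ∧ p = sep α β) ∨
      (∃ α ∈ Λ, p = vv α * Wv α - 1) ∨ ∃ α ∉ Λ, p = Wv α}
  have hsys : ∀ q (x : τ → K) α i, eval (Sum.elim q x) (sys α i) =
      eval (fun j => x (Sum.inl (α, j))) (map (eval q) (f i)) := by
    intro q x α i
    have : (eval (Sum.elim q x)).comp (eval₂Hom (rename Sum.inl).toRingHom (zv α)) =
        (eval fun j => x (Sum.inl (α, j))).comp (map (eval q)) := by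
      ext <;> simp [zv]
    exact RingHom.congr_fun this (f i)
  have hW : ∀ q (x : τ → K) α, eval (Sum.elim q x) (Wv α) =
      eval (fun j => x (Sum.inl (α, j))) W := by
    intro q x α
    have : (eval (Sum.elim q x)).comp (aeval (zv α)).toRingHom =
        (eval fun j => x (Sum.inl (α, j)) : MvPolynomial σ K →+* K) := by
      ext <;> simp [zv, algebraMap_eq]
    exact RingHom.congr_fun this W
  have hsep : ∀ q (x : τ → K) α β, eval (Sum.elim q x) (sep α β) =
      ∑ i, x (Sum.inr (Sum.inl (α, β, i))) * (x (Sum.inl (α, i)) - x (Sum.inl (β, i))) - 1 := by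
    intro q x α β
    simp [sep, uv, zv]
  have hv : ∀ q (x : τ → K) α, eval (Sum.elim q x) (vv α * Wv α - 1) =
      x (Sum.inr (Sum.inr α)) * eval (fun j => x (Sum.inl (α, j))) W - 1 := by
    intro q x α
    rw [map_sub, map_mul, hW, map_one]
    simp [vv]
  have key := exists_generic_solvable P ?_
  · obtain ⟨F, hF, hgen⟩ := key
    refine ⟨F, hF, fun q hq => ?_⟩
    obtain ⟨x, hx⟩ := hgen q hq
    refine ⟨fun α i => x (Sum.inl (α, i)), ?_, ?_, ?_⟩
    · intro α β hαβ
      by_contra hne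
      have := hx _ (Or.inr (Or.inl ⟨α, β, hne, rfl⟩))
      rw [hsep] at this
      simp [fun i => congrFun hαβ i] at this
    · intro α i
      rw [← hsys]
      exact hx _ (Or.inl ⟨α, i, rfl⟩)
    · intro α
      constructor
      · intro h0
        by_contra hα
        rw [← hW q] at h0
        exact h0 (hx _ (Or.inr (Or.inr (Or.inr ⟨α, hα, rfl⟩))))
      · intro hα h0
        have := hx _ (Or.inr (Or.inr (Or.inl ⟨α, hα, rfl⟩)))
        rw [hv, h0] at this
        simp at this
  · intro F hF
    obtain ⟨q, hq, Z, hZ, hZf, hZW⟩ := h F hF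
    refine ⟨q, hq, ?_⟩
    have hu : ∀ α β, ∃ u : σ → K, α ≠ β → ∑ i, u i * (Z α i - Z β i) = 1 := by
      intro α β
      by_cases hαβ : α = β
      · exact ⟨0, fun hne => absurd hαβ hne⟩
      obtain ⟨i, hi⟩ := Function.ne_iff.1 (hZ.ne hαβ)
      refine ⟨Pi.single i (Z α i - Z β i)⁻¹, fun _ => ?_⟩
      rw [Finset.sum_eq_single i (fun j _ hj => by simp [Pi.single_eq_of_ne hj]) (by simp)]
      simp [sub_ne_zero.2 hi]
    choose u hu using hu
    refine ⟨Sum.elim (fun a => Z a.1 a.2) (Sum.elim (fun a => u a.1 a.2.1 a.2.2)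
      fun α => (eval (Z α) W)⁻¹), ?_⟩
    rintro p (⟨α, i, rfl⟩ | ⟨α, β, hαβ, rfl⟩ | ⟨α, hα, rfl⟩ | ⟨α, hα, rfl⟩)
    · rw [hsys]
      exact hZf α i
    · rw [hsep]
      simp [hu α β hαβ]
    · rw [hv]
      simp [(hZW α).2 hα]
    · rw [hW]
      simpa using mt (hZW α).1 hα

/-! ### Solutions of the limit system. -/

/-- The solution of the limit system `y_{s,j} ^ r_{j+1} = c_j ∏ b, (-y_{b,j-1})` obtained by choosing
roots level by level, as prescribed by `α`. -/
noncomputable def limitLevel {k : ℕ} {r : ℕ → ℕ} (c : Fin k → ℂ)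
    (α : (i : Idx k r) → Fin (r (i.1 + 2))) : (j : ℕ) → Fin (r j) → ℂ
  | 0, _ => 0
  | j + 1, s => if h : j < k then
      Complex.exp (2 * Real.pi * Complex.I / r (j + 2)) ^ (α ⟨⟨j, h⟩, s⟩ : ℕ) *
        (c ⟨j, h⟩ * ∏ b : Fin (r j), (0 - limitLevel c α j b)) ^ ((r (j + 2) : ℂ)⁻¹) else 0

/-- The point with coordinates `limitLevel c α`. -/
noncomputable def limitPoint {k : ℕ} {r : ℕ → ℕ} (c : Fin k → ℂ)
    (α : (i : Idx k r) → Fin (r (i.1 + 2))) (i : Idx k r) : ℂ :=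
  limitLevel c α (i.1 + 1) i.2

section Limit

variable {k : ℕ} {r : ℕ → ℕ} {c : Fin k → ℂ} {α β : (i : Idx k r) → Fin (r (i.1 + 2))}

theorem level_limitPoint (j : ℕ) (a : Fin (r j)) :
    level (limitPoint c α) j a = limitLevel c α j a := by
  cases j with
  | zero => rfl
  | succ j =>
    rw [level]
    split_ifs with h
    · rfl
    · rw [limitLevel, dif_neg h]

theorem limitPoint_eq (i : Idx k r) : limitPoint c α i =
    Complex.exp (2 * Real.pi * Complex.I / r (i.1 + 2)) ^ (α i : ℕ) *
      (c i.1 * ∏ b : Fin (r i.1), (0 - level (limitPoint c α) i.1 b)) ^ ((r (i.1 + 2) : ℂ)⁻¹) := by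
  rw [limitPoint, limitLevel, dif_pos i.1.2]
  simp only [level_limitPoint]

theorem level_limitPoint_ne_zero (h0 : r 0 = 0) (hc : ∀ j, c j ≠ 0) (j : ℕ) (hj : j ≤ k)
    (a : Fin (r j)) : level (limitPoint c α) j a ≠ 0 := by
  induction j with
  | zero => exact absurd a.2 (by simp [h0])
  | succ j ih =>
    rw [level, dif_pos (Nat.lt_of_succ_le hj), limitPoint_eq]
    refine mul_ne_zero (pow_ne_zero _ (Complex.exp_ne_zero _)) ?_
    rw [Ne, Complex.cpow_eq_zero_iff, not_and_or]
    left
    refine mul_ne_zero (hc _) (Finset.prod_ne_zero_iff.2 fun b _ => ?_)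
    rw [zero_sub]
    exact neg_ne_zero.2 (ih (Nat.le_of_succ_le hj) b)

theorem limitPoint_ne_zero (h0 : r 0 = 0) (hc : ∀ j, c j ≠ 0) (i : Idx k r) :
    limitPoint c α i ≠ 0 := by
  rw [limitPoint, ← level_limitPoint]
  exact level_limitPoint_ne_zero h0 hc _ i.1.2 _

theorem scaledEqn_limitPoint (hpos : ∀ j < k, 0 < r (j + 2)) (i : Idx k r) :
    scaledEqn c 0 (limitPoint c α) i = 0 := by
  have hn := (hpos i.1 i.1.2).ne'
  have h1 := (Complex.isPrimitiveRoot_exp _ hn).pow_eq_one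
  have h2 : limitPoint c α i ^ r (i.1 + 2) =
      c i.1 * ∏ b : Fin (r i.1), (0 - level (limitPoint c α) i.1 b) := by
    conv_lhs => rw [limitPoint_eq]
    rw [mul_pow, ← pow_mul, mul_comm (α i : ℕ), pow_mul, h1, one_pow, one_mul,
      Complex.cpow_nat_inv_pow _ hn]
  simp only [scaledEqn, zero_mul, sub_zero, Finset.prod_const, Finset.card_univ, Fintype.card_fin]
  rw [h2, sub_self]

/-- Within one level, limit points distinguish the chosen roots. -/
theorem eq_of_limitPoint_eq (h0 : r 0 = 0) (hc : ∀ j, c j ≠ 0) (hpos : ∀ j < k, 0 < r (j + 2))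
    (j : Fin k) (s u : Fin (r (j + 1)))
    (hl : ∀ b, level (limitPoint c α) j b = level (limitPoint c β) j b)
    (h : limitPoint c α ⟨j, s⟩ = limitPoint c β ⟨j, u⟩) : α ⟨j, s⟩ = β ⟨j, u⟩ := by
  have hne : limitPoint c β ⟨j, u⟩ ≠ 0 := limitPoint_ne_zero h0 hc _
  rw [limitPoint_eq, limitPoint_eq] at h
  rw [limitPoint_eq] at hne
  simp only [hl] at h
  exact Fin.ext ((Complex.isPrimitiveRoot_exp _ (hpos j j.2).ne').pow_inj (α ⟨j, s⟩).2
    (β ⟨j, u⟩).2 (mul_right_cancel₀ (right_ne_zero_of_mul hne) h))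

theorem limitPoint_eq_limitPoint_iff (h0 : r 0 = 0) (hc : ∀ j, c j ≠ 0)
    (hpos : ∀ j < k, 0 < r (j + 2)) (j : Fin k) (s u : Fin (r (j + 1))) :
    limitPoint c α ⟨j, s⟩ = limitPoint c α ⟨j, u⟩ ↔ α ⟨j, s⟩ = α ⟨j, u⟩ := by
  refine ⟨eq_of_limitPoint_eq h0 hc hpos j s u fun _ => rfl, fun h => ?_⟩
  rw [limitPoint_eq, limitPoint_eq, h]

theorem limitPoint_injective (h0 : r 0 = 0) (hc : ∀ j, c j ≠ 0) (hpos : ∀ j < k, 0 < r (j + 2)) :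
    Function.Injective fun α : (i : Idx k r) → Fin (r (i.1 + 2)) => limitPoint c α := by
  intro α β h
  have h' : limitPoint c α = limitPoint c β := h
  refine funext fun ⟨j, s⟩ => ?_
  exact eq_of_limitPoint_eq h0 hc hpos j s s (fun b => by rw [h']) (by rw [h'])

end Limit

/-! ### Dense parameters, counting and conclusion. -/

/-- Choices of roots that are pairwise distinct on each level. -/
def distinctChoices (k : ℕ) (r : ℕ → ℕ) : Set ((i : Idx k r) → Fin (r (i.1 + 2))) :=
  {α | ∀ (j : Fin k) (s u : Fin (r (j + 1))), s ≠ u → α ⟨j, s⟩ ≠ α ⟨j, u⟩}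

/-- The parameters with a full set of distinct solutions are Zariski dense. -/
theorem exists_full_configuration (k : ℕ) (r : ℕ → ℕ) (h0 : r 0 = 0)
    (hpos : ∀ j < k, 0 < r (j + 2)) (hr : ∀ j < k, r j ≤ r (j + 2))
    (F : MvPolynomial (Fin k) ℂ) (hF : F ≠ 0) :
    ∃ q : Fin k → ℂ, eval q F ≠ 0 ∧
      ∃ Z : ((i : Idx k r) → Fin (r (i.1 + 2))) → Idx k r → ℂ, Function.Injective Z ∧
        (∀ α i, eval (Z α) (eqn k r q i) = 0) ∧
        ∀ α, NonDegenerate (Z α) ↔ α ∈ distinctChoices k r := by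
  classical
  obtain ⟨c, hFc⟩ : ∃ c : Fin k → ℂ, eval c (F * ∏ j, X j) ≠ 0 := by
    by_contra! h
    exact mul_ne_zero hF (Finset.prod_ne_zero_iff.2 fun j _ => X_ne_zero j)
      (MvPolynomial.funext fun c => by simpa using h c)
  simp only [map_mul, map_prod, eval_X, mul_ne_zero_iff, Finset.prod_ne_zero_iff, Finset.mem_univ,
    true_imp_iff, ne_eq] at hFc
  obtain ⟨hFc, hc⟩ := hFc
  have hgen : ∀ᶠ t in 𝓝[≠] (0 : ℂ), eval (scaledParam r c t) F ≠ 0 := by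
    let p : Polynomial ℂ := aeval (fun j : Fin k => Polynomial.C (c j) *
      Polynomial.X ^ ((j + 1) * r (j + 2) - j * r j)) F
    have hp : ∀ t, p.eval t = eval (scaledParam r c t) F := by
      intro t
      have : (Polynomial.evalRingHom t).comp (aeval (fun j : Fin k => Polynomial.C (c j) *
          Polynomial.X ^ ((j + 1) * r (j + 2) - j * r j))).toRingHom =
          eval (scaledParam r c t) := by
        ext <;> simp [scaledParam]
      exact RingHom.congr_fun this F
    -- At `t = 1` the rescaled parameter is `c` itself, where `F` does not vanish.
    have hp0 : p ≠ 0 := by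
      intro h
      have h1 := hp 1
      have h2 : scaledParam r c 1 = c := by ext; simp [scaledParam]
      rw [h, h2, Polynomial.eval_zero] at h1
      exact hFc h1.symm
    have hfin : {t | p.IsRoot t}.Finite := Polynomial.finite_setOfPred_isRoot hp0
    filter_upwards [nhdsNE_le_cofinite 0 hfin.compl_mem_cofinite] with t ht h
    exact ht ((hp t).trans h)
  -- Disjoint neighbourhoods of the limit points keep the deformed solutions distinct.
  obtain ⟨V, hV, hVd⟩ := (Set.toFinite (Set.range fun α : (i : Idx k r) → Fin (r (i.1 + 2)) =>
    limitPoint c α)).t2_separation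
  have hdef : ∀ α : (i : Idx k r) → Fin (r (i.1 + 2)), ∀ᶠ t in 𝓝 (0 : ℂ),
      ∃ y' ∈ V (limitPoint c α), (∀ i, scaledEqn c t y' i = 0) ∧
        (NonDegenerate y' ↔ α ∈ distinctChoices k r) := by
    intro α
    have hU : V (limitPoint c α) ∩ {y' | ∀ (j : Fin k) (s u : Fin (r (j + 1))),
        limitPoint c α ⟨j, s⟩ ≠ limitPoint c α ⟨j, u⟩ → y' ⟨j, s⟩ ≠ y' ⟨j, u⟩} ∈
        𝓝 (limitPoint c α) := by
      refine inter_mem ((hV _).2.mem_nhds (hV _).1) ?_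
      change ∀ᶠ y' in 𝓝 (limitPoint c α), ∀ (j : Fin k) (s u : Fin (r (j + 1))),
        limitPoint c α ⟨j, s⟩ ≠ limitPoint c α ⟨j, u⟩ → y' ⟨j, s⟩ ≠ y' ⟨j, u⟩
      simp only [eventually_all]
      intro j s u h
      exact (isOpen_ne_fun (continuous_apply (A := fun _ : Idx k r => ℂ) ⟨j, s⟩)
        (continuous_apply (A := fun _ : Idx k r => ℂ) ⟨j, u⟩)).mem_nhds h
    filter_upwards [eventually_exists_scaledEqn_eq_zero hpos c (limitPoint c α)
      (limitPoint_ne_zero h0 hc) (scaledEqn_limitPoint hpos) hU] with t ht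
    obtain ⟨y', ⟨hyV, hyne⟩, hy0, hyeq⟩ := ht
    refine ⟨y', hyV, hy0, forall_congr' fun j => forall_congr' fun s => forall_congr' fun u =>
      imp_congr_right fun _ => ?_⟩
    rw [← not_iff_not, not_not, not_not, ← limitPoint_eq_limitPoint_iff h0 hc hpos]
    exact ⟨fun h => by_contra fun hne => hyne j s u hne h, hyeq j s u⟩
  have hall : ∀ᶠ t in 𝓝[≠] (0 : ℂ), t ≠ 0 ∧ eval (scaledParam r c t) F ≠ 0 ∧
      ∀ α : (i : Idx k r) → Fin (r (i.1 + 2)), ∃ y' ∈ V (limitPoint c α),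
        (∀ i, scaledEqn c t y' i = 0) ∧ (NonDegenerate y' ↔ α ∈ distinctChoices k r) :=
    (eventually_mem_nhdsWithin).and (hgen.and
      (eventually_all.2 fun α => (hdef α).filter_mono nhdsWithin_le_nhds))
  obtain ⟨t, ht0, htF, hy⟩ := hall.exists
  choose Y hYV hY0 hYnd using hy
  refine ⟨scaledParam r c t, htF, fun α i => t ^ (i.1 + 1 : ℕ) * Y α i, ?_, ?_, ?_⟩
  · intro α β hαβ
    have hY : Y α = Y β := funext fun i =>
      mul_left_cancel₀ (pow_ne_zero _ ht0) (congrFun hαβ i)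
    refine limitPoint_injective h0 hc hpos ?_
    by_contra hne
    exact Set.disjoint_left.1 (hVd (Set.mem_range_self α) (Set.mem_range_self β) hne) (hYV α)
      (hY ▸ hYV β)
  · intro α i
    rw [eval_eqn_scale hr, hY0, mul_zero]
  · intro α
    rw [← hYnd]
    refine forall_congr' fun j => forall_congr' fun s => forall_congr' fun u =>
      imp_congr_right fun _ => ?_
    simp [ht0]

/-- The polynomial whose nonvanishing expresses non-degeneracy. -/
noncomputable def discrPoly (k : ℕ) (r : ℕ → ℕ) : MvPolynomial (Idx k r) ℂ :=
  ∏ j : Fin k, ∏ s : Fin (r (j + 1)), ∏ u : Fin (r (j + 1)),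
    if s = u then 1 else X ⟨j, s⟩ - X ⟨j, u⟩

theorem eval_discrPoly_ne_zero_iff {k : ℕ} {r : ℕ → ℕ} (z : Idx k r → ℂ) :
    eval z (discrPoly k r) ≠ 0 ↔ NonDegenerate z := by
  simp only [discrPoly, map_prod, Finset.prod_ne_zero_iff, Finset.mem_univ, true_imp_iff,
    NonDegenerate]
  refine forall_congr' fun j => forall_congr' fun s => forall_congr' fun u => ?_
  split_ifs with h
  · simp [h]
  · simp [h, sub_ne_zero]

theorem card_choices (k : ℕ) (r : ℕ → ℕ) :
    Nat.card ((i : Idx k r) → Fin (r (i.1 + 2))) = ∏ i : Idx k r, r (i.1 + 2) := by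
  simp

theorem prod_Idx_eq (k : ℕ) (r : ℕ → ℕ) :
    ∏ i : Idx k r, r (i.1 + 2) = ∏ j ∈ Finset.Icc 1 k, r (j + 1) ^ r j := by
  rw [Fintype.prod_sigma]
  simp only [Finset.prod_const, Finset.card_univ, Fintype.card_fin]
  rw [Fin.prod_univ_eq_prod_range (fun j => r (j + 2) ^ r (j + 1)) k, Finset.range_eq_Ico,
    Finset.prod_Ico_add' (fun j => r (j + 1) ^ r j) 0 k 1]
  rfl

theorem encard_distinctChoices (k : ℕ) (r : ℕ → ℕ)
    (hr : ∀ j, 1 ≤ j → j ≤ k → r j ≤ r (j + 1)) :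
    (distinctChoices k r).encard =
      ((∏ j ∈ Finset.Icc 1 k, (r (j + 1))! / (r (j + 1) - r j)! : ℕ) : ℕ∞) := by
  let e : distinctChoices k r ≃ ((j : Fin k) → Fin (r (j + 1)) ↪ Fin (r (j + 2))) :=
    { toFun := fun α j => ⟨fun s => α.1 ⟨j, s⟩, fun s u h => by_contra fun hne => α.2 j s u hne h⟩
      invFun := fun g => ⟨fun i => g i.1 i.2, fun j s u hne h => hne ((g j).injective h)⟩
      left_inv := fun α => rfl
      right_inv := fun g => rfl }
  rw [Set.encard, ENat.card_congr e, ENat.card_eq_coe_fintype_card]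
  congr 1
  rw [Fintype.card_pi]
  simp only [Fintype.card_embedding_eq, Fintype.card_fin]
  rw [Fin.prod_univ_eq_prod_range (fun j => (r (j + 2)).descFactorial (r (j + 1))) k,
    Finset.range_eq_Ico,
    Finset.prod_Ico_add' (fun j => (r (j + 1)).descFactorial (r j)) 0 k 1]
  refine Finset.prod_congr rfl fun j hj => ?_
  have hj' := Finset.mem_Ico.1 hj
  exact Nat.descFactorial_eq_div (hr j (by omega) (by omega))

end FlagBethe

theorem proposition4p7 (k : ℕ) (r : ℕ → ℕ) (h0 : r 0 = 0) (h1 : 0 < r 1)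
    (hr : ∀ j, 1 ≤ j → j ≤ k → r j ≤ r (j + 1)) :
    FlagBethe.ForGeneric k fun q =>
      FlagBethe.N k r q = ((∏ j ∈ Finset.Icc 1 k, r (j + 1) ^ r j : ℕ) : ℕ∞) ∧
      (FlagBethe.solutions k r q).encard = ((∏ j ∈ Finset.Icc 1 k, r (j + 1) ^ r j : ℕ) : ℕ∞) ∧
      {z ∈ FlagBethe.solutions k r q | FlagBethe.NonDegenerate z}.encard =
        ((∏ j ∈ Finset.Icc 1 k, (r (j + 1))! / (r (j + 1) - r j)! : ℕ) : ℕ∞) := by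
  have hpos' : ∀ j ≤ k, 0 < r (j + 1) := by
    intro j
    induction j with
    | zero => exact fun _ => h1
    | succ j ih => exact fun hj => (ih (by omega)).trans_le (hr (j + 1) (by omega) hj)
  have hpos : ∀ j < k, 0 < r (j + 2) := fun j hj => hpos' (j + 1) hj
  have hr2 : ∀ j < k, r j ≤ r (j + 2) := by
    intro j hj
    rcases Nat.eq_zero_or_pos j with rfl | hj0
    · simp [h0]
    · exact (hr j hj0 hj.le).trans (hr (j + 1) (by omega) hj)
  obtain ⟨F, hF, hle⟩ := FlagBethe.exists_generic_encard_solutions_le k r hr2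
  obtain ⟨G, hG, hconf⟩ := FlagBethe.exists_generic_configuration (FlagBethe.genericEqn k r)
    (FlagBethe.discrPoly k r) (FlagBethe.distinctChoices k r) (by
      simpa only [FlagBethe.map_genericEqn, FlagBethe.eval_discrPoly_ne_zero_iff] using
        FlagBethe.exists_full_configuration k r h0 hpos hr2)
  refine ⟨F * G, mul_ne_zero hF hG, fun q _ hq => ?_⟩
  rw [map_mul] at hq
  obtain ⟨Z, hZ, hZ0, hZnd⟩ := hconf q (right_ne_zero_of_mul hq)
  simp only [FlagBethe.map_genericEqn, FlagBethe.eval_discrPoly_ne_zero_iff] at hZ0 hZnd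
  have hcard : (Set.range Z).encard = ((∏ j ∈ Finset.Icc 1 k, r (j + 1) ^ r j : ℕ) : ℕ∞) := by
    rw [← Set.image_univ, hZ.encard_image, Set.encard_univ, ENat.card_eq_coe_natCard,
      FlagBethe.card_choices, FlagBethe.prod_Idx_eq]
  have hsub : Set.range Z ⊆ FlagBethe.solutions k r q := by
    rintro _ ⟨α, rfl⟩
    exact hZ0 α
  -- The constructed solutions already attain the upper bound, so there are no others.
  have hsol : Set.range Z = FlagBethe.solutions k r q := by
    refine (Set.finite_range Z).eq_of_subset_of_encard_le hsub ?_
    rw [hcard, ← FlagBethe.prod_Idx_eq]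
    exact hle q (left_ne_zero_of_mul hq)
  refine ⟨?_, ?_, ?_⟩
  · rw [FlagBethe.N_eq_encard_solutions, ← hsol, hcard]
  · rw [← hsol, hcard]
  · have : {z ∈ FlagBethe.solutions k r q | FlagBethe.NonDegenerate z} =
        Z '' FlagBethe.distinctChoices k r := by
      ext z
      rw [← hsol]
      constructor
      · rintro ⟨⟨α, rfl⟩, hz⟩
        exact ⟨α, (hZnd α).1 hz, rfl⟩
      · rintro ⟨α, hα, rfl⟩
        exact ⟨⟨α, rfl⟩, (hZnd α).2 hα⟩
    rw [this, hZ.encard_image, FlagBethe.encard_distinctChoices k r hr]
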